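/- Let $G$ be a connected simple graph, finite or infinite, of maximum valence $3$. The distinguishing number $D(G)$ is the least number of colors in a (not necessarily proper) coloring of the vertices of $G$ whose only color-preserving automorphism is the identity. For $n \ge 1$ let $T_n$ be the finite tree, unique up to isomorphism, in which all vertices have valence $1$ or $3$ and every vertex of valence $1$ has distance exactly $n$ from a fixed root vertex. If $G$ has a leaf, that is, a vertex of valence $1$, then $D(G)\le 2$ or $G$ is isomorphic to $T_n$ for some $n\ge 1$. -/

import Mathlib

namespace Distinguishing

variable {V : Type*}

/-- The valence of a vertex: the number of its neighbors, infinite if there are infinitely many. -/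
noncomputable def valence (G : SimpleGraph V) (v : V) : ℕ∞ :=
  (G.neighborSet v).encard

/-- The maximum valence of `G` exists and equals `d`. -/
def HasMaxValence (G : SimpleGraph V) (d : ℕ) : Prop :=
  IsGreatest (Set.range (valence G)) (d : ℕ∞)

/-- A leaf is a vertex of valence 1. -/
def IsLeaf (G : SimpleGraph V) (v : V) : Prop :=
  valence G v = 1

/-- A coloring (not necessarily proper) of the vertices is distinguishing if the only
color-preserving automorphism is the identity. -/
def IsDistinguishing {α : Type*} (G : SimpleGraph V) (c : V → α) : Prop :=
  ∀ φ : G ≃g G, (∀ v, c (φ v) = c v) → ∀ v, φ v = v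

/-- The distinguishing number: the least number of colors in a distinguishing coloring.
The value is infinite (not a junk value) if no finite number of colors suffices. -/
noncomputable def distinguishingNumber (G : SimpleGraph V) : ℕ∞ :=
  ⨅ (k : ℕ) (_ : ∃ c : V → Fin k, IsDistinguishing G c), (k : ℕ∞)

/-- `G` is (isomorphic to) `T(n, d)`: the finite tree in which all vertices have valence 1 or `d`
and every vertex of valence 1 has the same distance `n` from a root vertex.

For `n ≥ 1` and `d ≥ 2` this determines the graph up to isomorphism: the root is not a leaf, and by
finiteness every path leading away from the root extends until it ends in a leaf, at distance
exactly `n`; so the root has `d` children, every other vertex at distance less than `n` from the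
root has `d - 1` children, and the vertices at distance `n` have none. Without finiteness the
infinite `d`-regular tree, which has no leaf, would qualify as well. -/
def IsT (n d : ℕ) (G : SimpleGraph V) : Prop :=
  Finite V ∧ G.IsTree ∧ (∀ v, valence G v = 1 ∨ valence G v = (d : ℕ∞)) ∧
    ∃ root : V, ∀ v, IsLeaf G v → G.dist root v = n

end Distinguishing

/-!
Suppose that `G` has valence at most `k + 1`, where `2 ≤ k`, and that no coloring with `k` colors
is distinguishing. A breadth-first search from a vertex `l` yields a coloring that only the
identity preserves among the automorphisms fixing `l`: color siblings differently. If in addition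
few of the vertices two steps away from `l` resemble `l`, one color can be used so sparingly that
it singles out `l`.

Let the level of a vertex be the number of rounds of leaf deletion that it survives. When a vertex
is deleted it has exactly one neighbor left, its parent. Applied with levels as the measure of
resemblance, the breadth-first coloring must fail at every vertex; this forces each parent to have
valence `k + 1`, with at least `k` neighbors at the level of the child, so that levels increase by
one from child to parent, up to a vertex that is never deleted. If there were no such vertex, then
any two vertices of equal level would have a common ancestor the same number of steps away, and
coloring siblings differently would be distinguishing. So there is a vertex that is never deleted;
it is unique, all its neighbors have the same level, and the leaves are the vertices of level `0`,
hence at the same distance from it.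
-/

namespace Distinguishing

variable {V : Type*} {G : SimpleGraph V} {k : ℕ}

theorem encard_le_of_subset_of_notMem {α : Type*} {s t : Set α} {a : α} (hst : s ⊆ t) (ha : a ∈ t)
    (has : a ∉ s) (ht : t.encard ≤ k + 1) : s.encard ≤ k := by
  have h : s.encard + 1 ≤ k + 1 := by
    rw [← Set.encard_insert_of_notMem has]
    exact (Set.encard_le_encard (Set.insert_subset ha hst)).trans ht
  exact (ENat.add_le_add_iff_right ENat.one_ne_top).1 h

theorem exists_coloring_injOn_fibers {α β : Type*} (f : α → β)
    (hf : ∀ x, (f ⁻¹' {f x}).encard ≤ k) :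
    ∃ c : α → Fin k, (∀ x y, f x = f y → c x = c y → x = y) ∧
      ∀ x, ((c x : ℕ) : ℕ∞) < (f ⁻¹' {f x}).encard := by
  have hfib (b : β) : (f ⁻¹' {b}).encard ≤ k := by
    rcases (f ⁻¹' {b}).eq_empty_or_nonempty with h | ⟨x, rfl⟩
    · simp [h]
    · exact hf x
  have hfin (b : β) : (f ⁻¹' {b}).Finite := Set.finite_of_encard_le_coe (hfib b)
  have (b : β) : Finite (f ⁻¹' {b}) := hfin b
  have hcard (b : β) : (Nat.card (f ⁻¹' {b}) : ℕ∞) = (f ⁻¹' {b}).encard := by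
    rw [Nat.card_coe_set_eq, (hfin b).cast_ncard_eq]
  let e (b : β) : f ⁻¹' {b} ≃ Fin (Nat.card (f ⁻¹' {b})) := Finite.equivFin _
  refine ⟨fun x => (e (f x) ⟨x, rfl⟩).castLE (by exact_mod_cast (hcard _).trans_le (hfib _)),
    fun x y hxy hc => ?_, fun x => ?_⟩
  · have he (b : β) (hb : f y = b) : (e b ⟨y, hb⟩ : ℕ) = e (f y) ⟨y, rfl⟩ := by subst hb; rfl
    have hval : (e (f x) ⟨x, rfl⟩ : ℕ) = e (f x) ⟨y, hxy.symm⟩ :=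
      (Fin.ext_iff.1 hc).trans (he _ _).symm
    exact congrArg Subtype.val ((e (f x)).injective (Fin.ext hval))
  · rw [← hcard, Fin.val_castLE]
    exact_mod_cast (e (f x) ⟨x, rfl⟩).isLt

theorem dist_map {W : Type*} {H : SimpleGraph W} (φ : G ≃g H) (u v : V) :
    H.dist (φ u) (φ v) = G.dist u v := by
  simp only [SimpleGraph.dist_eq_sInf]
  congr 1
  ext n
  constructor
  · rintro ⟨p, rfl⟩
    exact ⟨(p.map φ.symm.toHom).copy (φ.symm_apply_apply u) (φ.symm_apply_apply v), by simp⟩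
  · rintro ⟨p, rfl⟩
    exact ⟨p.map φ.toHom, by simp⟩

theorem encard_neighborSet_inter_preimage_map {β : Type*} (φ : G ≃g G) {lab : V → β}
    (hlab : ∀ v, lab (φ v) = lab v) (v : V) (b : β) :
    (G.neighborSet (φ v) ∩ lab ⁻¹' {b}).encard = (G.neighborSet v ∩ lab ⁻¹' {b}).encard := by
  rw [← φ.injective.encard_image (G.neighborSet v ∩ lab ⁻¹' {b})]
  congr 1
  ext w
  obtain ⟨w, rfl⟩ := φ.surjective w
  rw [φ.injective.mem_set_image]
  simp [hlab, φ.map_adj_iff]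

theorem induction_of_connected (hc : G.Connected) {P : V → Prop} {a : V} (ha : P a)
    (h : ∀ x y, G.Adj x y → P x → P y) (b : V) : P b := by
  obtain ⟨p⟩ := hc a b
  induction p with
  | nil => exact ha
  | cons hadj _ ih => exact ih (h _ _ hadj ha)

/-- The neighbors of `x` that are closer to `l`: its parents in a breadth-first search from `l`. -/
def predecessors (G : SimpleGraph V) (l x : V) : Set V :=
  {q | G.Adj x q ∧ G.dist l q + 1 = G.dist l x}

theorem predecessors_self (l : V) : predecessors G l l = ∅ := by
  ext q
  simp [predecessors]

theorem predecessors_nonempty (hc : G.Connected) {l x : V} (hx : x ≠ l) :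
    (predecessors G l x).Nonempty := by
  obtain ⟨p, hp⟩ := hc.exists_walk_length_eq_dist x l
  cases p with
  | nil => exact absurd rfl hx
  | @cons _ q _ hxq p =>
    refine ⟨q, hxq, ?_⟩
    have hpq : G.dist q l ≤ p.length := SimpleGraph.dist_le p
    have hx := hxq.diff_dist_adj (u := l)
    rw [SimpleGraph.Walk.length_cons, SimpleGraph.dist_comm] at hp
    rw [SimpleGraph.dist_comm] at hpq
    omega

theorem predecessors_eq_empty_iff (hc : G.Connected) {l x : V} :
    predecessors G l x = ∅ ↔ x = l := by
  refine ⟨fun h => ?_, by rintro rfl; exact predecessors_self x⟩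
  by_contra hx
  exact (predecessors_nonempty hc hx).ne_empty h

theorem predecessors_map {W : Type*} {H : SimpleGraph W} (φ : G ≃g H) (l x : V) :
    predecessors H (φ l) (φ x) = φ '' predecessors G l x := by
  ext q
  obtain ⟨q, rfl⟩ := φ.surjective q
  rw [φ.injective.mem_set_image]
  simp only [predecessors, Set.mem_ofPred_eq, φ.map_adj_iff, dist_map]

theorem encard_fiber_predecessors_le {β : Type*} (hc : G.Connected)
    (hval : ∀ v, valence G v ≤ k + 1) (hk : 0 < k) (lab : V → β) {l : V}
    (hl : ∀ b, (G.neighborSet l ∩ lab ⁻¹' {b}).encard ≤ k) (x : V) :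
    ((fun y => (predecessors G l y, lab y)) ⁻¹' {(predecessors G l x, lab x)}).encard ≤ k := by
  set F := (fun y => (predecessors G l y, lab y)) ⁻¹' {(predecessors G l x, lab x)}
  have hF (y : V) (hy : y ∈ F) : predecessors G l y = predecessors G l x ∧ lab y = lab x :=
    Prod.ext_iff.1 hy
  rcases eq_or_ne x l with rfl | hx
  · have hsub : F ⊆ {x} := fun y hy =>
      (predecessors_eq_empty_iff hc).1 ((hF y hy).1.trans (predecessors_self x))
    calc F.encard ≤ 1 := by simpa using Set.encard_le_encard hsub
      _ ≤ k := by exact_mod_cast hk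
  obtain ⟨q, hq⟩ := predecessors_nonempty hc hx
  have hqF (y : V) (hy : y ∈ F) : q ∈ predecessors G l y := (hF y hy).1 ▸ hq
  rcases eq_or_ne q l with rfl | hql
  · have hsub : F ⊆ G.neighborSet q ∩ lab ⁻¹' {lab x} :=
      fun y hy => ⟨(hqF y hy).1.symm, (hF y hy).2⟩
    exact (Set.encard_le_encard hsub).trans (hl (lab x))
  · obtain ⟨t, htq, ht⟩ := predecessors_nonempty hc hql
    refine encard_le_of_subset_of_notMem (t := G.neighborSet q) (fun y hy => (hqF y hy).1.symm)
      htq (fun htF => ?_) (hval q)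
    have := (hqF t htF).2
    omega

theorem eq_of_injOn_fibers_predecessors {α β : Type*} {lab : V → β} {l : V}
    {c : V → α} (hinj : ∀ x y, predecessors G l x = predecessors G l y → lab x = lab y →
      c x = c y → x = y) (φ : G ≃g G) (hlab : ∀ v, lab (φ v) = lab v) (hcol : ∀ v, c (φ v) = c v)
    (hl : φ l = l) (x : V) : φ x = x := by
  induction h : G.dist l x using Nat.strong_induction_on generalizing x with
  | _ n ih =>
    refine hinj _ _ ?_ (hlab x) (hcol x)
    have hfix : Set.EqOn φ id (predecessors G l x) :=
      fun q hq => ih _ (by have := hq.2; omega) q rfl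
    calc predecessors G l (φ x) = predecessors G (φ l) (φ x) := by rw [hl]
      _ = φ '' predecessors G l x := predecessors_map φ l x
      _ = predecessors G l x := by rw [hfix.image_eq, Set.image_id]

theorem exists_isDistinguishing_of_root {β : Type*} (hc : G.Connected)
    (hval : ∀ v, valence G v ≤ k + 1) (hk : 0 < k) {lab : V → β}
    (hlab : ∀ (φ : G ≃g G) v, lab (φ v) = lab v) {l : V}
    (hl : ∀ b, (G.neighborSet l ∩ lab ⁻¹' {b}).encard ≤ k)
    (hfew : ∀ q, G.Adj l q → (G.neighborSet q ∩ lab ⁻¹' {lab l}).encard < k) :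
    ∃ c : V → Fin k, IsDistinguishing G c := by
  classical
  obtain ⟨c, hinj, hlt⟩ := exists_coloring_injOn_fibers _
    (encard_fiber_predecessors_le hc hval hk lab hl)
  simp only [Prod.mk.injEq] at hinj
  let last : Fin k := ⟨k - 1, by omega⟩
  refine ⟨Function.update c l last, fun φ hφ => ?_⟩
  -- Away from `l` the last color occurs only in fibers with `k` elements, and by `hfew` no image
  -- of `l` under an automorphism lies in such a fiber.
  have hfix : φ l = l := by
    by_contra hne
    have hlast : c (φ l) = last := by simpa [hne] using hφ l
    obtain ⟨q, hq⟩ := predecessors_nonempty hc hne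
    obtain ⟨q, rfl⟩ := φ.surjective q
    have hfiber : ((k - 1 : ℕ) : ℕ∞) < (G.neighborSet (φ q) ∩ lab ⁻¹' {lab (φ l)}).encard := by
      have h := hlt (φ l)
      rw [hlast] at h
      refine h.trans_le (Set.encard_le_encard fun y hy => ?_)
      obtain ⟨hpred, hy⟩ := Prod.mk.inj (Set.mem_singleton_iff.1 hy)
      exact ⟨(hpred ▸ hq : φ q ∈ predecessors G l y).1.symm, hy⟩
    rw [encard_neighborSet_inter_preimage_map φ (hlab φ), hlab] at hfiber
    have hle := Order.add_one_le_of_lt hfiber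
    rw [← Nat.cast_add_one, Nat.sub_add_cancel hk] at hle
    exact (hfew q (φ.map_adj_iff.1 hq.1)).not_ge hle
  refine eq_of_injOn_fibers_predecessors (fun x y hxy hlabxy hcxy => ?_) φ (hlab φ) hφ hfix
  have hroot : x = l ↔ y = l := by
    rw [← predecessors_eq_empty_iff hc, hxy, predecessors_eq_empty_iff hc]
  by_cases hx : x = l
  · exact hx.trans (hroot.1 hx).symm
  · exact hinj x y ⟨hxy, hlabxy⟩ (by simpa [hx, mt hroot.2 hx] using hcxy)

theorem exists_isDistinguishing_of_iterate_eq {f : V → V}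
    (hf : ∀ (φ : G ≃g G) v, f (φ v) = φ (f v)) (hfib : ∀ v, (f ⁻¹' {f v}).encard ≤ k)
    (h : ∀ (φ : G ≃g G) v, ∃ n, f^[n] (φ v) = f^[n] v) :
    ∃ c : V → Fin k, IsDistinguishing G c := by
  obtain ⟨c, hinj, -⟩ := exists_coloring_injOn_fibers f hfib
  refine ⟨c, fun φ hφ v => ?_⟩
  obtain ⟨n, hn⟩ := h φ v
  induction n generalizing v with
  | zero => exact hn
  | succ n ih =>
    rw [Function.iterate_succ_apply, Function.iterate_succ_apply, hf] at hn
    exact hinj _ _ ((hf φ v).trans (ih (f v) hn)) (hφ v)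

theorem exists_iterate_eq_iterate (hc : G.Connected) {f : V → V}
    (hf : ∀ x y, G.Adj x y → y = f x ∨ x = f y) (x y : V) : ∃ m n, f^[m] x = f^[n] y := by
  refine induction_of_connected hc (P := fun y => ∃ m n, f^[m] x = f^[n] y) ⟨0, 0, rfl⟩ ?_ y
  rintro y z hyz ⟨m, n, h⟩
  rcases hf y z hyz with rfl | rfl
  · exact ⟨m + 1, n, by
      rw [Function.iterate_succ_apply', h, ← Function.iterate_succ_apply,
        Function.iterate_succ_apply']⟩
  · exact ⟨m, n + 1, h⟩

theorem dist_add_one_eq_of_adj (hc : G.Connected) {f : V → V} {r : V} (hr : f r = r)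
    (hf : ∀ x y, G.Adj x y → y = f x ∨ x = f y) {x : V} (hx : x ≠ r) :
    G.dist r (f x) + 1 = G.dist r x := by
  induction h : G.dist r x using Nat.strong_induction_on generalizing x with
  | _ n ih =>
    obtain ⟨q, hxq, hq⟩ := predecessors_nonempty hc hx
    rcases hf x q hxq with rfl | rfl
    · omega
    · have hqr : q ≠ r := by
        rintro rfl
        exact hx hr
      have := ih (G.dist r q) (by omega) hqr rfl
      omega

theorem isTree_of_adj [Finite V] (hc : G.Connected) {f : V → V} {r : V} (hr : f r = r)
    (hf : ∀ x y, G.Adj x y → y = f x ∨ x = f y) : G.IsTree := by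
  refine SimpleGraph.isTree_iff_connected_and_card.2
    ⟨hc, le_antisymm ?_ hc.card_vert_le_card_edgeSet_add_one⟩
  have hsub : G.edgeSet ⊆ (fun x => s(x, f x)) '' {r}ᶜ := by
    intro e he
    induction e with
    | _ x y =>
      have hxy : G.Adj x y := he
      rcases hf x y he with rfl | rfl
      · exact ⟨x, fun hx => hxy.ne (by rw [Set.mem_singleton_iff.1 hx, hr]), rfl⟩
      · exact ⟨y, fun hy => hxy.ne (by rw [Set.mem_singleton_iff.1 hy, hr]), Sym2.eq_swap⟩
  have hcard : G.edgeSet.ncard ≤ ({r}ᶜ : Set V).ncard :=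
    (Set.ncard_le_ncard hsub).trans (Set.ncard_image_le)
  have := Set.ncard_add_ncard_compl {r}
  rw [Set.ncard_singleton] at this
  rw [Nat.card_coe_set_eq]
  omega

theorem finite_setOf_dist_le (hc : G.Connected) (hfin : ∀ v, (G.neighborSet v).Finite) (r : V)
    (n : ℕ) : {x | G.dist r x ≤ n}.Finite := by
  induction n with
  | zero =>
    refine (Set.finite_singleton r).subset fun x hx => ?_
    exact (hc.dist_eq_zero_iff.1 (Nat.le_zero.1 hx)).symm
  | succ n ih =>
    refine ((ih.biUnion fun v _ => hfin v).insert r).subset fun x hx => ?_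
    refine or_iff_not_imp_left.2 fun hxr => ?_
    obtain ⟨q, hxq, hq⟩ := predecessors_nonempty hc hxr
    refine Set.mem_biUnion (x := q) ?_ hxq.symm
    rw [Set.mem_ofPred_eq] at hx ⊢
    omega

/-- What remains of `G` after deleting `n` times all leaves of the remaining induced subgraph. -/
def core (G : SimpleGraph V) : ℕ → Set V
  | 0 => Set.univ
  | n + 1 => {v ∈ core G n | ¬ ∃! q, G.Adj v q ∧ q ∈ core G n}

/-- The number of rounds of leaf deletion that `v` survives; it is `⊤` if `v` is never deleted. -/
noncomputable def level (G : SimpleGraph V) (v : V) : ℕ∞ :=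
  ⨆ (n : ℕ) (_ : v ∈ core G n), (n : ℕ∞)

theorem core_antitone (G : SimpleGraph V) : Antitone (core G) :=
  antitone_nat_of_succ_le fun _ _ h => h.1

theorem mem_core_iff {v : V} {n : ℕ} : v ∈ core G n ↔ n ≤ level G v := by
  refine ⟨fun h => le_iSup₂_of_le n h le_rfl, fun h => ?_⟩
  by_contra hv
  cases n with
  | zero => exact hv trivial
  | succ n =>
    have hle : level G v ≤ n := by
      refine iSup₂_le fun m hm => Nat.cast_le.2 (Nat.lt_succ_iff.1 (lt_of_not_ge fun hnm => ?_))
      exact hv (core_antitone G hnm hm)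
    exact absurd (Nat.cast_le.1 (h.trans hle)) n.not_succ_le_self

theorem map_mem_core_iff (φ : G ≃g G) (n : ℕ) (v : V) : φ v ∈ core G n ↔ v ∈ core G n := by
  induction n generalizing v with
  | zero => exact Iff.rfl
  | succ n ih =>
    refine and_congr (ih v) (not_congr ?_)
    exact (φ.toEquiv.existsUnique_congr fun {q} => and_congr φ.map_adj_iff.symm (ih q).symm).symm

theorem level_map (φ : G ≃g G) (v : V) : level G (φ v) = level G v := by
  simp only [level, map_mem_core_iff]

theorem lt_level_iff {v : V} {n : ℕ} :
    n < level G v ↔ n ≤ level G v ∧ ¬ ∃! q, G.Adj v q ∧ n ≤ level G q := by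
  rw [← ENat.add_one_le_iff (ENat.natCast_ne_top n), ← Nat.cast_add_one]
  simp only [← mem_core_iff]
  rfl

theorem existsUnique_adj_level_le {v : V} (hv : level G v ≠ ⊤) :
    ∃! q, G.Adj v q ∧ level G v ≤ level G q := by
  obtain ⟨n, hn⟩ := ENat.ne_top_iff_exists.1 hv
  by_contra h
  rw [← hn] at h
  exact hn.not_lt (lt_level_iff.2 ⟨hn.le, h⟩)

theorem level_eq_zero_of_isLeaf {v : V} (hv : IsLeaf G v) : level G v = 0 := by
  obtain ⟨q, hq⟩ := Set.encard_eq_one.1 hv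
  have hadj (w : V) : G.Adj v w ↔ w = q := Set.ext_iff.1 hq w
  refine nonpos_iff_eq_zero.1 (le_of_not_gt fun h => ?_)
  exact (lt_level_iff (n := 0).1 h).2 ⟨q, by simp [hadj], fun w hw => (hadj w).1 hw.1⟩

open Classical in
/-- The only neighbor of `v` that is left when `v` is deleted, or `v` itself if `v` is never
deleted. -/
noncomputable def parent (G : SimpleGraph V) (v : V) : V :=
  if hv : level G v = ⊤ then v else (existsUnique_adj_level_le hv).choose

theorem parent_of_level_eq_top {v : V} (hv : level G v = ⊤) : parent G v = v :=
  dif_pos hv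

theorem parent_spec {v : V} (hv : level G v ≠ ⊤) :
    G.Adj v (parent G v) ∧ level G v ≤ level G (parent G v) := by
  rw [parent, dif_neg hv]
  exact (existsUnique_adj_level_le hv).choose_spec.1

theorem adj_parent {v : V} (hv : level G v ≠ ⊤) : G.Adj v (parent G v) :=
  (parent_spec hv).1

theorem eq_parent {v q : V} (hv : level G v ≠ ⊤) (hvq : G.Adj v q)
    (hle : level G v ≤ level G q) : q = parent G v :=
  (existsUnique_adj_level_le hv).unique ⟨hvq, hle⟩ (parent_spec hv)

theorem parent_map (φ : G ≃g G) (v : V) : parent G (φ v) = φ (parent G v) := by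
  by_cases hv : level G v = ⊤
  · rw [parent_of_level_eq_top hv, parent_of_level_eq_top ((level_map φ v).trans hv)]
  · refine (eq_parent (by rwa [level_map]) (φ.map_adj_iff.2 (adj_parent hv)) ?_).symm
    simpa only [level_map] using (parent_spec hv).2

/-- The neighbors of `v` of level `n`. -/
def levelNeighbors (G : SimpleGraph V) (v : V) (n : ℕ∞) : Set V :=
  G.neighborSet v ∩ level G ⁻¹' {n}

theorem encard_levelNeighbors_le_one {q : V} {n : ℕ∞} (hq : level G q ≠ ⊤)
    (hn : level G q ≤ n) : (levelNeighbors G q n).encard ≤ 1 := by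
  refine Set.encard_le_one_iff.2 fun a b ha hb => ?_
  rw [eq_parent hq ha.1 (hn.trans ha.2.ge), eq_parent hq hb.1 (hn.trans hb.2.ge)]

/-- A connected graph of valence at most `k + 1` that no coloring with `k` colors distinguishes. -/
structure IsIndistinguishable (G : SimpleGraph V) (k : ℕ) : Prop where
  connected : G.Connected
  valence_le : ∀ v, valence G v ≤ k + 1
  not_isDistinguishing : ∀ c : V → Fin k, ¬ IsDistinguishing G c

namespace IsIndistinguishable

theorem exists_le_encard_levelNeighbors (h : IsIndistinguishable G k) (hk : 0 < k) {v : V}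
    (hv : ∀ n, (levelNeighbors G v n).encard ≤ k) :
    ∃ q, G.Adj v q ∧ k ≤ (levelNeighbors G q (level G v)).encard := by
  by_contra! hfew
  obtain ⟨c, hc⟩ := exists_isDistinguishing_of_root h.connected h.valence_le hk level_map hv hfew
  exact h.not_isDistinguishing c hc

theorem le_encard_levelNeighbors_parent (h : IsIndistinguishable G k) (hk : 2 ≤ k) {v : V}
    (hv : level G v ≠ ⊤) : k ≤ (levelNeighbors G (parent G v) (level G v)).encard := by
  have hone : (1 : ℕ∞) < k := by exact_mod_cast hk
  obtain ⟨q, hvq, hq⟩ := h.exists_le_encard_levelNeighbors (v := v) (by omega) fun n => by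
    rcases le_or_gt (level G v) n with hn | hn
    · exact (encard_levelNeighbors_le_one hv hn).trans hone.le
    · refine encard_le_of_subset_of_notMem Set.inter_subset_left (adj_parent hv) (fun hp => ?_)
        (h.valence_le v)
      exact hn.not_ge ((parent_spec hv).2.trans hp.2.le)
  rcases le_or_gt (level G v) (level G q) with hle | hlt
  · rwa [← eq_parent hv hvq hle]
  · exact absurd (hq.trans (encard_levelNeighbors_le_one hlt.ne_top hlt.le)) hone.not_ge

theorem level_lt_level_parent (h : IsIndistinguishable G k) (hk : 2 ≤ k) {v : V}
    (hv : level G v ≠ ⊤) : level G v < level G (parent G v) := by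
  refine (parent_spec hv).2.lt_of_ne fun heq => ?_
  have hle := (h.le_encard_levelNeighbors_parent hk hv).trans
    (encard_levelNeighbors_le_one (heq ▸ hv) heq.ge)
  have : k ≤ 1 := by exact_mod_cast hle
  omega

theorem finite_neighborSet (h : IsIndistinguishable G k) (v : V) : (G.neighborSet v).Finite :=
  Set.finite_of_encard_le_coe (k := k + 1) (by exact_mod_cast h.valence_le v)

theorem neighborSet_parent_eq_insert (h : IsIndistinguishable G k) (hk : 2 ≤ k) {v q : V}
    (hv : level G v ≠ ⊤) (hq : G.Adj (parent G v) q) (hqv : level G q ≠ level G v) :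
    G.neighborSet (parent G v) = insert q (levelNeighbors G (parent G v) (level G v)) := by
  have hsub : insert q (levelNeighbors G (parent G v) (level G v)) ⊆ G.neighborSet (parent G v) :=
    Set.insert_subset hq Set.inter_subset_left
  refine (((h.finite_neighborSet _).subset hsub).eq_of_subset_of_encard_le hsub ?_).symm
  rw [Set.encard_insert_of_notMem fun hmem => hqv hmem.2]
  exact (h.valence_le _).trans (add_le_add_left (h.le_encard_levelNeighbors_parent hk hv) 1)

theorem level_lt_of_adj_parent (h : IsIndistinguishable G k) (hk : 2 ≤ k) {v q : V}
    (hv : level G v ≠ ⊤) (hq : G.Adj (parent G v) q) (hqv : level G q ≠ level G v) :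
    level G v < level G q := by
  by_contra! hle
  have hqtop : level G q ≠ ⊤ := ne_top_of_le_ne_top hv hle
  have hpq : parent G v = parent G q := eq_parent hqtop hq.symm (hle.trans (parent_spec hv).2)
  have hsub : levelNeighbors G (parent G v) (level G q) ⊆ {q} := fun w hw => by
    have hmem : w ∈ insert q (levelNeighbors G (parent G v) (level G v)) :=
      h.neighborSet_parent_eq_insert hk hv hq hqv ▸ hw.1
    exact hmem.resolve_right fun hw' => hqv (hw.2.symm.trans hw'.2)
  have hcard : (k : ℕ∞) ≤ 1 := by
    calc (k : ℕ∞) ≤ (levelNeighbors G (parent G v) (level G q)).encard :=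
          hpq ▸ h.le_encard_levelNeighbors_parent hk hqtop
      _ ≤ 1 := by simpa using Set.encard_le_encard hsub
  have : k ≤ 1 := by exact_mod_cast hcard
  omega

theorem level_parent_eq_or (h : IsIndistinguishable G k) (hk : 2 ≤ k) {v : V}
    (hv : level G v ≠ ⊤) : (∀ q, G.Adj (parent G v) q → level G q = level G v) ∨
      level G (parent G v) = level G v + 1 := by
  by_contra! hcon
  obtain ⟨⟨q, hq, hqv⟩, hne⟩ := hcon
  have hlt := (Order.add_one_le_of_lt (h.level_lt_level_parent hk hv)).lt_of_ne' hne
  have hltq := Order.add_one_le_of_lt (h.level_lt_of_adj_parent hk hv hq hqv)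
  obtain ⟨n, hn⟩ := ENat.ne_top_iff_exists.1 hv
  rw [← hn, ← Nat.cast_add_one] at hlt hltq
  refine (lt_level_iff.1 hlt).2 ⟨q, ⟨hq, hltq⟩, fun w hw => ?_⟩
  have hmem : w ∈ insert q (levelNeighbors G (parent G v) (level G v)) :=
    h.neighborSet_parent_eq_insert hk hv hq hqv ▸ hw.1
  refine hmem.resolve_right fun hw' => ?_
  have hle := hw.2.trans (hw'.2.trans hn.symm).le
  exact n.not_succ_le_self (Nat.cast_le.1 hle)

theorem level_parent (h : IsIndistinguishable G k) (hk : 2 ≤ k) {v : V}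
    (hv : level G v ≠ ⊤) (hp : level G (parent G v) ≠ ⊤) :
    level G (parent G v) = level G v + 1 := by
  refine (h.level_parent_eq_or hk hv).resolve_left fun hall => ?_
  have hlt := (h.level_lt_level_parent hk hv).trans (h.level_lt_level_parent hk hp)
  exact hlt.ne' (hall _ (adj_parent hp))

theorem level_eq_of_adj_parent (h : IsIndistinguishable G k) (hk : 2 ≤ k) {v q : V}
    (hv : level G v ≠ ⊤) (hp : level G (parent G v) = ⊤) (hq : G.Adj (parent G v) q) :
    level G q = level G v := by
  refine (h.level_parent_eq_or hk hv).resolve_right (fun hsucc => ?_) q hq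
  exact WithTop.add_ne_top.2 ⟨hv, ENat.one_ne_top⟩ (hsucc.symm.trans hp)

theorem valence_parent (h : IsIndistinguishable G k) (hk : 2 ≤ k) {v : V}
    (hv : level G v ≠ ⊤) : valence G (parent G v) = k + 1 := by
  refine (h.valence_le _).antisymm ?_
  by_cases hp : level G (parent G v) = ⊤
  · by_contra! hlt
    obtain ⟨q, hq, hle⟩ := h.exists_le_encard_levelNeighbors (v := parent G v) (by omega) fun n =>
      (Set.encard_le_encard Set.inter_subset_left).trans (Order.le_of_lt_add_one hlt)
    have hqtop : level G q ≠ ⊤ := h.level_eq_of_adj_parent hk hv hp hq ▸ hv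
    have hcard := hle.trans (encard_levelNeighbors_le_one hqtop (hp ▸ le_top))
    have : k ≤ 1 := by exact_mod_cast hcard
    omega
  · have hlt := (h.level_lt_level_parent hk hv).trans (h.level_lt_level_parent hk hp)
    calc (k : ℕ∞) + 1 ≤ (levelNeighbors G (parent G v) (level G v)).encard + 1 :=
          add_le_add_left (h.le_encard_levelNeighbors_parent hk hv) 1
      _ = (insert (parent G (parent G v))
            (levelNeighbors G (parent G v) (level G v))).encard :=
          (Set.encard_insert_of_notMem fun hmem => hlt.ne' hmem.2).symm
      _ ≤ valence G (parent G v) :=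
          Set.encard_le_encard (Set.insert_subset (adj_parent hp) Set.inter_subset_left)

theorem level_ne_top_of_adj (h : IsIndistinguishable G k) (hk : 2 ≤ k)
    (hfin : ∃ v, level G v ≠ ⊤) {x y : V} (hx : level G x = ⊤) (hxy : G.Adj x y) :
    level G y ≠ ⊤ := by
  obtain ⟨v, hv⟩ := hfin
  refine induction_of_connected h.connected
    (P := fun x => level G x = ⊤ → ∀ y, G.Adj x y → level G y ≠ ⊤) (a := v)
    (fun htop => absurd htop hv) (fun a b hab ha hb y hby => ?_) x hx y hxy
  have hatop : level G a ≠ ⊤ := fun hatop => ha hatop b hab hb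
  obtain rfl := eq_parent hatop hab (hb ▸ le_top)
  exact h.level_eq_of_adj_parent hk hatop hb hby ▸ hatop

theorem eq_parent_or_eq_parent (h : IsIndistinguishable G k) (hk : 2 ≤ k)
    (hfin : ∃ v, level G v ≠ ⊤) (x y : V) (hxy : G.Adj x y) :
    y = parent G x ∨ x = parent G y := by
  rcases le_total (level G x) (level G y) with hle | hle
  · exact .inl (eq_parent (fun hx => h.level_ne_top_of_adj hk hfin hx hxy
      (top_le_iff.1 (hx ▸ hle))) hxy hle)
  · exact .inr (eq_parent (fun hy => h.level_ne_top_of_adj hk hfin hy hxy.symm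
      (top_le_iff.1 (hy ▸ hle))) hxy.symm hle)

theorem encard_fiber_parent_le (h : IsIndistinguishable G k) (hk : 2 ≤ k)
    (hlev : ∀ v, level G v ≠ ⊤) (v : V) : (parent G ⁻¹' {parent G v}).encard ≤ k := by
  have hmem (w : V) (hw : parent G w = parent G v) : G.Adj (parent G v) w :=
    hw ▸ (adj_parent (hlev w)).symm
  refine encard_le_of_subset_of_notMem hmem (adj_parent (hlev (parent G v))) (fun hp => ?_)
    (h.valence_le (parent G v))
  have hlt := (h.level_lt_level_parent hk (hlev (parent G v))).trans
    (h.level_lt_level_parent hk (hlev _))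
  exact hlt.ne' (congrArg (level G) hp)

theorem level_iterate_parent (h : IsIndistinguishable G k) (hk : 2 ≤ k)
    (hlev : ∀ v, level G v ≠ ⊤) (n : ℕ) (v : V) :
    level G ((parent G)^[n] v) = level G v + n := by
  induction n with
  | zero => simp
  | succ n ih =>
    rw [Function.iterate_succ_apply', h.level_parent hk (hlev _) (hlev _), ih, add_assoc,
      Nat.cast_add_one]

theorem exists_level_eq_top (h : IsIndistinguishable G k) (hk : 2 ≤ k) :
    ∃ r, level G r = ⊤ := by
  by_contra! hlev
  have hanc (φ : G ≃g G) (v : V) : ∃ n, (parent G)^[n] (φ v) = (parent G)^[n] v := by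
    obtain ⟨m, n, hmn⟩ := exists_iterate_eq_iterate h.connected
      (h.eq_parent_or_eq_parent hk ⟨v, hlev v⟩) (φ v) v
    have hlevel := congrArg (level G) hmn
    rw [h.level_iterate_parent hk hlev, h.level_iterate_parent hk hlev, level_map] at hlevel
    obtain rfl : m = n :=
      Nat.cast_injective (ENat.add_right_injective_of_ne_top (hlev v) hlevel)
    exact ⟨m, hmn⟩
  obtain ⟨c, hc⟩ := exists_isDistinguishing_of_iterate_eq parent_map
    (h.encard_fiber_parent_le hk hlev) hanc
  exact h.not_isDistinguishing c hc

theorem valence_eq (h : IsIndistinguishable G k) (hk : 2 ≤ k) (hfin : ∃ v, level G v ≠ ⊤)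
    (v : V) : valence G v = 1 ∨ valence G v = k + 1 := by
  refine or_iff_not_imp_left.2 fun hone => ?_
  suffices hchild : ∃ w, level G w ≠ ⊤ ∧ parent G w = v by
    obtain ⟨w, hw, rfl⟩ := hchild
    exact h.valence_parent hk hw
  by_cases hv : level G v = ⊤
  · obtain ⟨u, hu⟩ := hfin
    have hvu : v ≠ u := fun hvu => hu (hvu ▸ hv)
    obtain ⟨w, hvw, -⟩ := predecessors_nonempty h.connected hvu
    have hw := h.level_ne_top_of_adj hk ⟨u, hu⟩ hv hvw
    exact ⟨w, hw, (eq_parent hw hvw.symm (hv ▸ le_top)).symm⟩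
  · obtain ⟨w, hvw, hne⟩ : ∃ w, G.Adj v w ∧ w ≠ parent G v := by
      by_contra! hall
      refine hone (Set.encard_eq_one.2 ⟨parent G v, Set.Subset.antisymm hall ?_⟩)
      exact Set.singleton_subset_iff.2 (adj_parent hv)
    have hlt : level G w < level G v := lt_of_not_ge fun hle => hne (eq_parent hv hvw hle)
    exact ⟨w, hlt.ne_top, (eq_parent hlt.ne_top hvw.symm hlt.le).symm⟩

theorem exists_level_add_dist_eq (h : IsIndistinguishable G k) (hk : 2 ≤ k)
    (hfin : ∃ v, level G v ≠ ⊤) {r : V} (hr : level G r = ⊤) :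
    ∃ n : ℕ, 1 ≤ n ∧ ∀ x, x ≠ r → level G x + G.dist r x = n := by
  have hdist {x : V} (hx : x ≠ r) : G.dist r (parent G x) + 1 = G.dist r x :=
    dist_add_one_eq_of_adj h.connected (parent_of_level_eq_top hr)
      (h.eq_parent_or_eq_parent hk hfin) hx
  have hlev {x : V} (hx : x ≠ r) : level G x ≠ ⊤ := fun htop => by
    have := hdist hx
    rw [parent_of_level_eq_top htop] at this
    omega
  obtain ⟨v, hv⟩ := hfin
  have hrv : r ≠ v := fun hrv => hv (hrv ▸ hr)
  obtain ⟨q, hrq, -⟩ := predecessors_nonempty h.connected hrv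
  have hq : level G q ≠ ⊤ := hlev hrq.ne'
  obtain rfl := eq_parent hq hrq.symm (hr ▸ le_top)
  obtain ⟨m, hm⟩ := ENat.ne_top_iff_exists.1 hq
  refine ⟨m + 1, by omega, fun x hx => ?_⟩
  induction hn : G.dist (parent G q) x using Nat.strong_induction_on generalizing x with
  | _ n ih =>
    rw [← hn, ← hdist hx]
    by_cases hpx : parent G x = parent G q
    · rw [h.level_eq_of_adj_parent hk hq hr (hpx ▸ (adj_parent (hlev hx)).symm), hpx, ← hm]
      simp
    · have := ih _ (by rw [← hn, ← hdist hx]; exact Nat.lt_succ_self _) _ hpx rfl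
      rw [h.level_parent hk (hlev hx) (hlev hpx)] at this
      rw [← this]
      push_cast
      ring

theorem exists_isT (h : IsIndistinguishable G k) (hk : 2 ≤ k) (hleaf : ∃ v, IsLeaf G v) :
    ∃ n : ℕ, 1 ≤ n ∧ IsT n (k + 1) G := by
  have hfin : ∃ v, level G v ≠ ⊤ := by
    obtain ⟨v, hv⟩ := hleaf
    exact ⟨v, by simp [level_eq_zero_of_isLeaf hv]⟩
  obtain ⟨r, hr⟩ := h.exists_level_eq_top hk
  obtain ⟨n, hn, hlevel⟩ := h.exists_level_add_dist_eq hk hfin hr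
  have hdist (x : V) : G.dist r x ≤ n := by
    rcases eq_or_ne x r with rfl | hx
    · simp
    · exact Nat.cast_le.1 (le_add_self.trans_eq (hlevel x hx))
  have : Finite V := Set.finite_univ_iff.1 <|
    (finite_setOf_dist_le h.connected h.finite_neighborSet r n).subset fun x _ => hdist x
  refine ⟨n, hn, this, isTree_of_adj h.connected (parent_of_level_eq_top hr)
    (h.eq_parent_or_eq_parent hk hfin), by exact_mod_cast h.valence_eq hk hfin, r, fun v hv => ?_⟩
  have hvr : v ≠ r := by
    rintro rfl
    simp [level_eq_zero_of_isLeaf hv] at hr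
  simpa [level_eq_zero_of_isLeaf hv] using hlevel v hvr

end IsIndistinguishable

theorem distinguishingNumber_le {c : V → Fin k} (hc : IsDistinguishing G c) :
    distinguishingNumber G ≤ k :=
  iInf₂_le k ⟨c, hc⟩

end Distinguishing

theorem theorem4p1_general {V : Type*} (G : SimpleGraph V) {k : ℕ} (hk : 2 ≤ k)
    (hconn : G.Connected) (hval : ∀ v, Distinguishing.valence G v ≤ k + 1)
    (hleaf : ∃ v, Distinguishing.IsLeaf G v) :
    Distinguishing.distinguishingNumber G ≤ k ∨
      ∃ n : ℕ, 1 ≤ n ∧ Distinguishing.IsT n (k + 1) G := by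
  refine or_iff_not_imp_left.2 fun hlarge => ?_
  have h : Distinguishing.IsIndistinguishable G k :=
    ⟨hconn, hval, fun _ hc => hlarge (Distinguishing.distinguishingNumber_le hc)⟩
  exact h.exists_isT hk hleaf

theorem theorem4p1 {V : Type*} (G : SimpleGraph V) (hconn : G.Connected)
    (hmax : Distinguishing.HasMaxValence G 3)
    (hleaf : ∃ v, Distinguishing.IsLeaf G v) :
    Distinguishing.distinguishingNumber G ≤ 2 ∨
      ∃ n : ℕ, 1 ≤ n ∧ Distinguishing.IsT n 3 G :=
  theorem4p1_general G le_rfl hconn (fun v => hmax.2 ⟨v, rfl⟩) hleaf
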